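/- Let $m,d\ge 1$. A generalized $m$-linear diagram with $v$ points per sector and cliques $K_d$ is a partition of $mv$ points on a circle, numbered $1,\dots,mv$ in circular order and cut into $m$ sectors $\{sv+1,\dots,sv+v\}$, $0\le s<m$, into blocks (cliques) of exactly $d$ points each, which is invariant under the rotation by $v$ points. A loop is a pair of consecutive points of the same sector that lie in the same clique. Let $a_{v,k}^{(m,d)}$ be the number of such diagrams having exactly $k$ loops in each of the $m$ sectors, with $a_{v,k}^{(m,d)}=0$ if $v<0$ or $k<0$. For integers $l\ge 1$, $y\ge 0$, $w$, define $q_{\kappa,j}=q_{\kappa,j}^{(l,w,y)}$ by $q_{0,0}=1$, $q_{\kappa,j}=0$ for $\kappa<0$ or $\kappa>j$, and, for $j\ge 0$ and $0\le\kappa\le j+1$, $$q_{\kappa,j+1}=[2j+y-(\kappa-1)]\,q_{\kappa-1,j}+(\kappa+1)(l-1)\,q_{\kappa+1,j}+[l(w+j+1)-(2j-\kappa+y)-\kappa(l-1)]\,q_{\kappa,j},$$ and for $u\ge 0$ put $$\hat p_u^{(l,w,y)}=\sum_{i=0}^{u}(-1)^i\,\frac{u!}{(u-i)!}\,q_{0,u-i}^{(l,w,y)}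 .$$ Then for all integers $m\ge1$, $d\ge 1$, $v\ge 1$ and $k\ge 0$, $$a_{v,k}^{(m,d)}=\sum_{\substack{l\mid m\\ m\mid ld}}\ \sum_{t=k-\tilde d+1}^{k+\tilde d-1} c_{k,t}\cdot a_{v-\tilde d,\,t}^{(m,d)},\qquad \tilde d=\frac{ld}{m},$$ where, with $y=t+i-k$ and $u=\tilde d-2i-t+k-1$, $$c_{k,t}=\sum_{i=0}^{\tilde d-1}\binom{\tilde d-1}{i}\binom{t}{y}\,\frac{l^{\,y}}{u!}\,\hat p_{u}^{(l,\;v-\tilde d-(k-i),\;y)},$$ terms with $y<0$ or $u<0$ being zero ($c_{k,t}$ depends also on $l$, $\tilde d$ and $v$). -/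

import Mathlib

/-- The `m * v` points of a diagram that is cut into `m` sectors with `v` points each: `(s, j)` is
the `j`-th point (counted from `0`, from left to right) of the `s`-th sector, that is, the point
number `s * v + j` of the circle. -/
abbrev SectorPoint (m v : ℕ) : Type := ZMod m × Fin v

/-- The rotation of the circle by `v` points, which carries each sector to the next one. -/
def sectorRotation (m v : ℕ) (p : SectorPoint m v) : SectorPoint m v := (p.1 + 1, p.2)

/-- A generalized `m`-linear diagram with `v` points in each sector: a partition of the points
into cliques `K_d` of exactly `d` points, invariant under the rotation by one sector. -/
structure IsMLinearDiagram (m d v : ℕ) (r : Setoid (SectorPoint m v)) : Prop where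
  clique_card : ∀ p, {q | r q p}.ncard = d
  symmetric : ∀ p q, r (sectorRotation m v p) (sectorRotation m v q) ↔ r p q

/-- The loops in the sector `s`: the pairs of neighbouring points `j`, `j + 1` of that sector which
lie in the same clique (the last point of a sector and the first point of the next one are not
neighbours). A loop is recorded by its left point. -/
def sectorLoops {m v : ℕ} (r : Setoid (SectorPoint m v)) (s : ZMod m) : Set (Fin v) :=
  {j | ∃ h : (j : ℕ) + 1 < v, r (s, j) (s, ⟨(j : ℕ) + 1, h⟩)}

/-- `a_{v,k}^{(m,d)}`: the number of generalized `m`-linear diagrams with cliques `K_d`, with `v`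
points in each sector and exactly `k` loops in each sector. -/
noncomputable def numMLinear (m d v k : ℕ) : ℕ :=
  {r : Setoid (SectorPoint m v) |
    IsMLinearDiagram m d v r ∧ ∀ s, (sectorLoops r s).ncard = k}.ncard

/-- The numbers `q_{κ,j}` for `l` cliques, `w` old points and `y` destroyed loops, given by
their recurrence in `j`. -/
def qNum (l : ℕ) (w : ℤ) (y : ℕ) : ℕ → ℤ → ℤ
  | 0, κ => if κ = 0 then 1 else 0
  | j + 1, κ =>
    if κ < 0 ∨ (j : ℤ) + 1 < κ then 0 else
      (2 * j + y - (κ - 1)) * qNum l w y j (κ - 1)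
      + (κ + 1) * ((l : ℤ) - 1) * qNum l w y j (κ + 1)
      + (l * (w + j + 1) - (2 * j - κ + y) - κ * ((l : ℤ) - 1)) * qNum l w y j κ

/-- The numbers `p̂_u`, expressed through the numbers `q_{0,j}` by inclusion–exclusion. -/
def pHat (l : ℕ) (w : ℤ) (y u : ℕ) : ℚ :=
  ∑ i ∈ Finset.range (u + 1),
    (-1 : ℚ) ^ i * ((u.factorial : ℚ) / ((u - i).factorial : ℚ)) * (qNum l w y (u - i) 0 : ℚ)

/-- The coefficient `c_{k,t}` for sectors of `v` points, when `l` cliques with `e` points in each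
sector are added. With `y = t + i - k` and `u = e - 2 i - t + k - 1`, the terms with `y < 0` or
`u < 0` are zero. -/
def cCoeff (l e v k t : ℕ) : ℚ :=
  ∑ i ∈ Finset.range e,
    if k ≤ t + i ∧ 2 * i + t + 1 ≤ e + k then
      ((e - 1).choose i : ℚ) * (t.choose (t + i - k) : ℚ)
        * ((l : ℚ) ^ (t + i - k) / ((e + k - (2 * i + t + 1)).factorial : ℚ))
        * pHat l ((v : ℤ) - e - ((k : ℤ) - i)) (t + i - k) (e + k - (2 * i + t + 1))
    else 0

/-!
The clique of the first point of the circle decides the recurrence. Its stabilizer in the group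
`ZMod m` of rotations consists of the multiples of some `l ∣ m` (`existsUnique_hasOrbitCard`), so its
orbit consists of `l` cliques, which have `e = l * d / m` points in each sector. Write `none` at the
positions of a sector that lie outside the orbit, and at the other positions the clique of the
orbit, numbered by `ZMod l`, that the point belongs to. This gives a word over `Option (ZMod l)` that
starts with `some 0`, and the points outside the orbit form a diagram with `v - e` points per sector.
Conversely `glue` recovers the diagram from the word and the smaller diagram (`glue_colourWord`,
`glue_injective`), and turns the loops of the pair into the loops of the diagram
(`ncard_sectorLoops_glue`).

It remains to count the words with `k` loops for a smaller diagram with `t` loops. Let `X` mark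
loops, let `x` mark new points, and put `s = l - 1 + X`. After a given new point, a run of further new
points contributes `1 / (1 - s x)`. A gap between old points is empty or holds a nonempty run, the
latter contributing `G = l x / (1 - s x)`; an empty gap contributes `X` if it is a loop. Hence the
words are counted by `(X + G) ^ t * (1 + G) ^ (v - e - t) / (1 - s x)` (`loopPoly_eq_coeff`). Expanding
both powers, and separating the `i` loops between new points and the `y = t + i - k` destroyed loops,
gives the sum that defines `cCoeff`, once `pHat` is known in closed form
(`coeff_coeff_eq_cCoeff`).

For the closed form, the recurrence of `qNum l (f + y) y` says that the polynomials
`∑ κ, qNum l (f + y) y j κ * X ^ κ` have the exponential generating function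
`(1 + (1 - X) x) ^ (f + 1) / (1 - s x) ^ (f + y + 1)`. As `1 + (1 - X) x = (1 - s x) + l x`, this is an
explicit sum of powers of `s` (`qPoly`), for which the recurrence is an identity between binomial
coefficients (`add_mul_choose_mul_multichoose`). Setting `X = 0` and dividing by `1 + x`, which is what
the alternating sum in `pHat` does, gives `pHat_div_factorial`.
-/

/-! ### The closed form of the numbers `q` and `p̂` -/

/-- The identity between the coefficients of `qPoly` that corresponds to the recurrence of `qNum`:
`i` times the product is expanded by Pascal's rule for `multichoose`, and `n` times the product by
absorption. -/
theorem add_mul_choose_mul_multichoose (a l y i n : ℕ) :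
    ((i + n : ℕ) : ℚ) * (a.choose i * (l : ℚ) ^ i * (y + i).multichoose n) =
      (if i = 0 then 0 else
        l * ((a : ℚ) - i + 1) *
          (a.choose (i - 1) * (l : ℚ) ^ (i - 1) * (y + (i - 1)).multichoose n)) +
      (if n = 0 then 0 else
        ((y : ℚ) + 2 * i + n - 1) *
          (a.choose i * (l : ℚ) ^ i * (y + i).multichoose (n - 1))) := by
  have hC : ∀ i : ℕ, ((i : ℚ) + 1) * a.choose (i + 1) = (a - i) * a.choose i := by
    intro i
    rcases le_or_gt i a with h | h
    · have := Nat.choose_succ_right_eq a i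
      have h2 : ((a.choose (i + 1) * (i + 1) : ℕ) : ℚ) = (a.choose i * (a - i) : ℕ) := by
        exact_mod_cast this
      push_cast [Nat.cast_sub h] at h2
      linarith
    · rw [Nat.choose_eq_zero_of_lt h, Nat.choose_eq_zero_of_lt (by omega)]; simp
  have hM : ∀ k n : ℕ, ((n : ℚ) + 1) * k.multichoose (n + 1) = (k + n) * k.multichoose n := by
    intro k n
    rcases k with _ | k
    · rcases n with _ | n <;> simp
    · rw [Nat.multichoose_eq, Nat.multichoose_eq]
      have := Nat.add_one_mul_choose_eq (k + n) n
      have e1 : k + 1 + (n + 1) - 1 = k + n + 1 := by omega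
      have e2 : k + 1 + n - 1 = k + n := by omega
      rw [e1, e2]
      have h2 : (((k + n + 1) * (k + n).choose n : ℕ) : ℚ)
        = ((k + n + 1).choose (n + 1) * (n + 1) : ℕ) := by exact_mod_cast this
      push_cast at h2 ⊢
      linarith
  rcases i with _ | i
  · rcases n with _ | n
    · simp
    · have := hM y n
      simp
      linear_combination (1 : ℚ) * this
  · rcases n with _ | n
    · have := hC i
      simp [pow_succ]
      linear_combination (l : ℚ) * l ^ i * this
    · have h1 := hC i
      have h2 := hM (y + i + 1) n
      have h3 := Nat.multichoose_succ_succ (y + i) n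
      have h3' : ((y + i + 1).multichoose (n + 1) : ℚ) =
          (y + i).multichoose (n + 1) + (y + i + 1).multichoose n := by exact_mod_cast h3
      have e : y + (i + 1) = y + i + 1 := by ring
      simp only [e, Nat.add_sub_cancel, if_neg (Nat.succ_ne_zero _)]
      push_cast at h1 h2 ⊢
      generalize ((y + i + 1).multichoose (n + 1) : ℚ) = M at *
      generalize ((y + i + 1).multichoose n : ℚ) = M1 at *
      generalize ((y + i).multichoose (n + 1) : ℚ) = M2 at *
      generalize (a.choose (i + 1) : ℚ) = c1 at *
      generalize (a.choose i : ℚ) = c0 at *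
      rw [pow_succ]
      linear_combination (c1 * l ^ i * l) * h2 + (l ^ i * l * M2) * h1
        + (i + 1) * c1 * l ^ i * l * h3'

open Polynomial in
/-- The polynomial `∑ κ, qNum l (f + y) y j κ * X ^ κ`, divided by the factorial of `j`, where
`a = f + 1`. It is given as a polynomial in `X + (l - 1)`: the coefficient of `x ^ j` in
`(1 + l x / B) ^ a * B ^ (-y)` with `B = 1 - (X + (l - 1)) x`. -/
noncomputable def qPoly (l a y j : ℕ) : ℚ[X] :=
  ∑ p ∈ Finset.HasAntidiagonal.antidiagonal j,
    C (a.choose p.1 * (l : ℚ) ^ p.1 * (y + p.1).multichoose p.2) * (X + C ((l : ℚ) - 1)) ^ p.2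

open Polynomial in
/-- The recurrence of `qNum` in the form of a differential equation in `X`. -/
theorem qPoly_succ (l f y j : ℕ) :
    C ((j : ℚ) + 1) * qPoly l (f + 1) y (j + 1) =
      (C (2 * (j : ℚ) + y) * X + C (l * ((f : ℚ) + y + j + 1) - (2 * j + y))) *
          qPoly l (f + 1) y j
        + (1 - X) * (X + C ((l : ℚ) - 1)) * derivative (qPoly l (f + 1) y j) := by
  set S : ℚ[X] := X + C ((l : ℚ) - 1) with hS
  set g : ℕ → ℕ → ℚ := fun i n =>
    ((f + 1).choose i * (l : ℚ) ^ i * (y + i).multichoose n) with hg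
  have hX : (X : ℚ[X]) = S - C ((l : ℚ) - 1) := by rw [hS]; ring
  have hL : C ((j : ℚ) + 1) * qPoly l (f + 1) y (j + 1) =
      ∑ p ∈ Finset.HasAntidiagonal.antidiagonal j, C (l * ((f : ℚ) + 1 - p.1) * g p.1 p.2) * S ^ p.2 +
      ∑ p ∈ Finset.HasAntidiagonal.antidiagonal j,
        C (((y : ℚ) + 2 * p.1 + p.2) * g p.1 p.2) * S ^ (p.2 + 1) := by
    have h1 : C ((j : ℚ) + 1) * qPoly l (f + 1) y (j + 1) =
        ∑ p ∈ Finset.HasAntidiagonal.antidiagonal (j + 1),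
          (C (if p.1 = 0 then 0 else l * (((f + 1 : ℕ) : ℚ) - p.1 + 1) * g (p.1 - 1) p.2) * S ^ p.2
          + C (if p.2 = 0 then 0 else ((y : ℚ) + 2 * p.1 + p.2 - 1) * g p.1 (p.2 - 1))
            * S ^ p.2) := by
      rw [qPoly, Finset.mul_sum]
      refine Finset.sum_congr rfl fun p hp => ?_
      rw [Finset.HasAntidiagonal.mem_antidiagonal] at hp
      have hp' : (j : ℚ) + 1 = ((p.1 + p.2 : ℕ) : ℚ) := by rw [hp]; push_cast; ring
      rw [← mul_assoc, ← C_mul, hp', add_mul_choose_mul_multichoose, C_add, add_mul]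
    rw [h1, Finset.sum_add_distrib, Finset.Nat.sum_antidiagonal_succ,
      Finset.Nat.sum_antidiagonal_succ']
    simp only [if_true, C_0, zero_mul, zero_add, if_neg (Nat.succ_ne_zero _), Nat.add_sub_cancel]
    congr 1
    · refine Finset.sum_congr rfl fun p _ => ?_
      congr 3; push_cast; ring
    · refine Finset.sum_congr rfl fun p _ => ?_
      congr 3; push_cast; ring
  rw [hL, qPoly, derivative_sum, Finset.mul_sum, Finset.mul_sum, ← Finset.sum_add_distrib,
    ← Finset.sum_add_distrib]
  refine Finset.sum_congr rfl fun p hp => ?_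
  rw [Finset.HasAntidiagonal.mem_antidiagonal] at hp
  have hp' : (j : ℚ[X]) = (p.1 : ℚ[X]) + p.2 := by rw [← hp]; push_cast; ring
  have hd : S * derivative (S ^ p.2) = (p.2 : ℚ[X]) * S ^ p.2 := by
    rw [derivative_pow]
    have : derivative S = 1 := by simp [hS]
    rw [this]
    rcases Nat.eq_zero_or_pos p.2 with h | h
    · simp [h]
    · obtain ⟨n, hn⟩ := Nat.exists_eq_succ_of_ne_zero h.ne'
      rw [hn]; simp [pow_succ]; ring
  change _ = _ * (C (g p.1 p.2) * S ^ p.2) + _ * derivative (C (g p.1 p.2) * S ^ p.2)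
  rw [derivative_C_mul]
  have e : (1 - X) * S * (C (g p.1 p.2) * derivative (S ^ p.2)) =
    C (g p.1 p.2) * (1 - X) * (S * derivative (S ^ p.2)) := by ring
  rw [e, hd, hX]
  simp only [C_mul, C_add, C_sub, map_natCast, C_1, map_ofNat, hp', pow_succ]
  ring

open Polynomial in
theorem qPoly_natDegree_le (l a y j : ℕ) : (qPoly l a y j).natDegree ≤ j := by
  refine natDegree_sum_le_of_forall_le _ _ fun p hp => ?_
  rw [Finset.HasAntidiagonal.mem_antidiagonal] at hp
  refine (natDegree_C_mul_le _ _).trans ((natDegree_pow_le).trans ?_)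
  rw [natDegree_X_add_C]; omega

open Polynomial in
theorem qNum_eq_coeff_qPoly (l f y j : ℕ) (κ : ℤ) :
    (qNum l ((f : ℤ) + y) y j κ : ℚ) =
      if κ < 0 then 0 else (j.factorial : ℚ) * (qPoly l (f + 1) y j).coeff κ.toNat := by
  induction j generalizing κ with
  | zero =>
    simp only [qNum, qPoly]
    rcases lt_trichotomy κ 0 with h | h | h
    · simp [h, h.ne]
    · simp [h]
    · have : κ.toNat ≠ 0 := by omega
      simp [h.ne', h.not_gt, coeff_one, this]
  | succ j ih =>
    rw [qNum]
    by_cases h0 : κ < 0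
    · simp [h0]
    by_cases h1 : (j : ℤ) + 1 < κ
    · have : (qPoly l (f + 1) y (j + 1)).coeff κ.toNat = 0 := by
        apply coeff_eq_zero_of_natDegree_lt
        have := qPoly_natDegree_le l (f + 1) y (j + 1)
        omega
      simp [h0, h1, this]
    rw [if_neg (by tauto), if_neg h0]
    push_cast
    rw [ih, ih, ih]
    have key := congrArg (fun p => p.coeff κ.toNat) (qPoly_succ l f y j)
    simp only [coeff_C_mul] at key
    rw [Nat.factorial_succ]
    push_cast
    rw [mul_comm ((j : ℚ) + 1), mul_assoc (j.factorial : ℚ), key]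
    obtain ⟨n, rfl⟩ := Int.eq_ofNat_of_zero_le (not_lt.mp h0)
    have e : (1 - X) * (X + C ((l : ℚ) - 1)) * derivative (qPoly l (f + 1) y j) =
      C ((l : ℚ) - 1) * derivative (qPoly l (f + 1) y j)
      + C (2 - (l : ℚ)) * (X * derivative (qPoly l (f + 1) y j))
      - X * (X * derivative (qPoly l (f + 1) y j)) := by
      simp only [C_sub, C_1, map_ofNat]; ring
    rw [e, add_mul (C _ * X), mul_assoc (C _) X]
    simp only [coeff_add, coeff_sub, coeff_C_mul]
    rcases n with _ | n
    · simp [coeff_derivative]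
      ring
    · have t1 : ((n + 1 : ℕ) : ℤ) - 1 = (n : ℤ) := by push_cast; ring
      have t2 : ((n + 1 : ℕ) : ℤ) + 1 = ((n + 2 : ℕ) : ℤ) := by push_cast; ring
      rw [t1, t2]
      simp only [Int.toNat_natCast, coeff_X_mul, if_neg (Int.natCast_nonneg _ |>.not_gt),
        coeff_derivative]
      rcases n with _ | n
      · simp [coeff_derivative]
        ring
      · simp only [coeff_X_mul, coeff_derivative]
        push_cast
        ring

theorem qNum_zero_eq_sum (l f y j : ℕ) :
    (qNum l ((f : ℤ) + y) y j 0 : ℚ) = (j.factorial : ℚ) *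
      ∑ p ∈ Finset.HasAntidiagonal.antidiagonal j,
        ((f + 1).choose p.1 * (l : ℚ) ^ p.1 * (y + p.1).multichoose p.2) *
          ((l : ℚ) - 1) ^ p.2 := by
  rw [qNum_eq_coeff_qPoly, if_neg (lt_irrefl _), qPoly]
  simp [Polynomial.coeff_zero_eq_eval_zero, Polynomial.eval_finsetSum]

/-- A closed form for `pHat`: divided by the factorial of `u`, it is the coefficient of `x ^ u` in
`(1 + x) ^ f * (1 - (l - 1) * x) ^ (-(f + y + 1))`. -/
theorem pHat_div_factorial (l f y u : ℕ) :
    pHat l ((f : ℤ) + y) y u / (u.factorial : ℚ) =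
      ∑ p ∈ Finset.HasAntidiagonal.antidiagonal u,
        (f.choose p.1 * (l : ℚ) ^ p.1 * (y + p.1 + 1).multichoose p.2) *
          ((l : ℚ) - 1) ^ p.2 := by
  induction u with
  | zero => simp [pHat, qNum]
  | succ u ih =>
    have hrec : pHat l ((f : ℤ) + y) y (u + 1) / ((u + 1).factorial : ℚ) =
        (qNum l ((f : ℤ) + y) y (u + 1) 0 : ℚ) / ((u + 1).factorial : ℚ)
          - pHat l ((f : ℤ) + y) y u / (u.factorial : ℚ) := by
      have hu : ((u + 1).factorial : ℚ) ≠ 0 := by positivity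
      have hu' : (u.factorial : ℚ) ≠ 0 := by positivity
      rw [pHat, Finset.sum_range_succ', pHat]
      simp only [Nat.add_sub_add_right]
      rw [add_div, Finset.sum_div, Finset.sum_div, add_comm, sub_eq_add_neg,
        ← Finset.sum_neg_distrib]
      congr 1
      · simp [div_self hu]
      · refine Finset.sum_congr rfl fun i _ => ?_
        have : ((u - i).factorial : ℚ) ≠ 0 := by positivity
        field_simp
        ring
    rw [hrec, ih, qNum_zero_eq_sum, mul_div_assoc, mul_comm, div_mul_cancel₀ _ (by positivity),
      sub_eq_iff_eq_add]
    -- Pascal's rule for `choose (f + 1) b` on the left, for `multichoose` on the right.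
    have hL : ∑ p ∈ Finset.HasAntidiagonal.antidiagonal (u + 1),
        ((f + 1).choose p.1 * (l : ℚ) ^ p.1 * (y + p.1).multichoose p.2) * ((l : ℚ) - 1) ^ p.2 =
        ∑ p ∈ Finset.HasAntidiagonal.antidiagonal (u + 1),
        (f.choose p.1 * (l : ℚ) ^ p.1 * (y + p.1).multichoose p.2) * ((l : ℚ) - 1) ^ p.2 +
        ∑ p ∈ Finset.HasAntidiagonal.antidiagonal u,
        (f.choose p.1 * (l : ℚ) ^ (p.1 + 1) * (y + p.1 + 1).multichoose p.2) *
          ((l : ℚ) - 1) ^ p.2 := by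
      rw [Finset.Nat.sum_antidiagonal_succ, Finset.Nat.sum_antidiagonal_succ, add_assoc,
        ← Finset.sum_add_distrib]
      congr 1
      · simp
      · refine Finset.sum_congr rfl fun p _ => ?_
        rw [Nat.choose_succ_succ, ← add_assoc]
        push_cast
        ring
    have hR : ∑ p ∈ Finset.HasAntidiagonal.antidiagonal (u + 1),
        (f.choose p.1 * (l : ℚ) ^ p.1 * (y + p.1 + 1).multichoose p.2) * ((l : ℚ) - 1) ^ p.2 =
        ∑ p ∈ Finset.HasAntidiagonal.antidiagonal (u + 1),
        (f.choose p.1 * (l : ℚ) ^ p.1 * (y + p.1).multichoose p.2) * ((l : ℚ) - 1) ^ p.2 +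
        ∑ p ∈ Finset.HasAntidiagonal.antidiagonal u,
        (f.choose p.1 * (l : ℚ) ^ p.1 * (y + p.1 + 1).multichoose p.2) *
          ((l : ℚ) - 1) ^ (p.2 + 1) := by
      rw [Finset.Nat.sum_antidiagonal_succ', Finset.Nat.sum_antidiagonal_succ',
        add_assoc (G := ℚ), ← Finset.sum_add_distrib]
      congr 1
      · simp
      · refine Finset.sum_congr rfl fun p _ => ?_
        rw [Nat.multichoose_succ_succ]
        push_cast
        ring
    rw [hL, hR, add_assoc, ← Finset.sum_add_distrib]
    congr 1
    refine Finset.sum_congr rfl fun p _ => ?_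
    ring

/-! ### Words that insert new points into a row of old points -/

section Words

variable {A : Type*}

/-- The number of old letters of the word `g` before the position `j`. -/
def oldBefore {n : ℕ} (g : Fin n → Option A) (j : Fin n) : ℕ :=
  open Classical in (Finset.univ.filter fun i => i < j ∧ g i = none).card

/-- A word over `Option A` describes how new points, coloured by `A`, are inserted into a row of old
points (the letters `none`); `φ i` says that the old points number `i` and `i + 1` form a loop.
`IsWordLoop φ g j` says that the letters at `j` and `j + 1` form a loop of the resulting row: they
are two new points of the same colour, or two old points which formed a loop before. -/
def IsWordLoop (φ : ℕ → Prop) {n : ℕ} (g : Fin n → Option A) (j : Fin n) : Prop :=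
  ∃ h : (j : ℕ) + 1 < n, g ⟨j + 1, h⟩ = g j ∧ (g j = none → φ (oldBefore g j))

/-- The number of loops of the word `g`. -/
noncomputable def wordLoops (φ : ℕ → Prop) {n : ℕ} (g : Fin n → Option A) : ℕ :=
  open Classical in (Finset.univ.filter fun j => IsWordLoop φ g j).card

theorem oldBefore_cons_succ {n : ℕ} (a : Option A) (g : Fin n → Option A) (j : Fin n) :
    oldBefore (Fin.cons a g : Fin (n + 1) → Option A) j.succ =
      oldBefore g j + if a = none then 1 else 0 := by
  classical
  simp only [oldBefore, Fin.card_filter_univ_succ]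
  by_cases ha : a = none <;> simp [ha]

theorem isWordLoop_cons_succ (φ : ℕ → Prop) {n : ℕ} (a : Option A) (g : Fin n → Option A)
    (j : Fin n) :
    IsWordLoop φ (Fin.cons a g : Fin (n + 1) → Option A) j.succ ↔
      IsWordLoop (fun i => φ (i + if a = none then 1 else 0)) g j := by
  simp only [IsWordLoop, oldBefore_cons_succ, Fin.cons_succ, Fin.val_succ]
  constructor
  · rintro ⟨h, h1, h2⟩
    exact ⟨by omega, h1, h2⟩
  · rintro ⟨h, h1, h2⟩
    exact ⟨by omega, h1, h2⟩

theorem isWordLoop_cons_cons_zero (φ : ℕ → Prop) {n : ℕ} (a b : Option A) (g : Fin n → Option A) :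
    IsWordLoop φ (Fin.cons a (Fin.cons b g : Fin (n + 1) → Option A) : Fin (n + 2) → Option A) 0 ↔
      b = a ∧ (a = none → φ 0) := by
  simp [IsWordLoop, oldBefore]

open Classical in
theorem wordLoops_cons_cons (φ : ℕ → Prop) {n : ℕ} (a b : Option A) (g : Fin n → Option A) :
    wordLoops φ (Fin.cons a (Fin.cons b g : Fin (n + 1) → Option A) : Fin (n + 2) → Option A) =
      wordLoops (fun i => φ (i + if a = none then 1 else 0))
        (Fin.cons b g : Fin (n + 1) → Option A) +
      if b = a ∧ (a = none → φ 0) then 1 else 0 := by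
  rw [wordLoops, Fin.card_filter_univ_succ, wordLoops]
  simp only [isWordLoop_cons_succ, isWordLoop_cons_cons_zero]
  split_ifs <;> rfl

variable [Fintype A]

open Polynomial in
/-- The polynomial that counts, by their loops, the words `a g` where `g` has length `n` and `r` old
letters. -/
noncomputable def loopPoly (φ : ℕ → Prop) (a : Option A) (n r : ℕ) : ℚ[X] :=
  open Classical in ∑ g : Fin n → Option A,
    if (Finset.univ.filter fun j => g j = none).card = r then
      X ^ wordLoops φ (Fin.cons a g : Fin (n + 1) → Option A) else 0

open Polynomial in
theorem loopPoly_zero (φ : ℕ → Prop) (a : Option A) : loopPoly φ a 0 0 = 1 := by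
  have h (g : Fin 0 → Option A) : wordLoops φ (Fin.cons a g : Fin 1 → Option A) = 0 := by
    classical
    refine Finset.card_eq_zero.mpr (Finset.filter_eq_empty_iff.mpr fun j _ hj => ?_)
    obtain ⟨hj, -⟩ := hj
    omega
  simp [loopPoly, h]

theorem loopPoly_eq_zero (φ : ℕ → Prop) (a : Option A) {n r : ℕ} (h : n < r) :
    loopPoly φ a n r = 0 := by
  classical
  refine Finset.sum_eq_zero fun g _ => if_neg fun hg => ?_
  have := Finset.card_filter_le (Finset.univ : Finset (Fin n)) (fun j => g j = none)
  rw [Finset.card_univ, Fintype.card_fin] at this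
  omega

open Polynomial in
open Classical in
/-- The recurrence for `loopPoly` that reads off the first letter after `a`. -/
theorem loopPoly_succ (φ : ℕ → Prop) (a : Option A) (n r : ℕ) :
    loopPoly φ a (n + 1) r =
      (∑ b : A, (if some b = a then X else 1) *
        loopPoly (fun i => φ (i + if a = none then 1 else 0)) (some b) n r) +
      if r = 0 then 0 else (if a = none ∧ φ 0 then X else 1) *
        loopPoly (fun i => φ (i + if a = none then 1 else 0)) (none : Option A) n (r - 1) := by
  let e : Option A × (Fin n → Option A) ≃ (Fin (n + 1) → Option A) :=
    Fin.consEquiv fun _ : Fin (n + 1) => Option A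
  have he (p) : e p = Fin.cons p.1 p.2 := rfl
  rw [loopPoly, ← e.sum_comp, Fintype.sum_prod_type, Fintype.sum_option, add_comm]
  simp only [he, wordLoops_cons_cons, Fin.card_filter_univ_succ, Fin.cons_zero,
    Fin.cons_succ, pow_add]
  congr 1
  · refine Finset.sum_congr rfl fun b _ => ?_
    rw [loopPoly, Finset.mul_sum]
    refine Finset.sum_congr rfl fun g _ => ?_
    have : (some b = a ∧ (a = none → φ 0)) ↔ some b = a := by
      constructor
      · exact fun h => h.1
      · rintro rfl; simp
    simp only [this, reduceCtorEq, if_false]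
    split_ifs <;> simp [mul_comm]
  · rcases r with _ | r
    · simp
    · rw [if_neg (Nat.succ_ne_zero r), loopPoly, Finset.mul_sum]
      refine Finset.sum_congr rfl fun g _ => ?_
      have : (none = a ∧ (a = none → φ 0)) ↔ (a = none ∧ φ 0) := by
        constructor
        · exact fun h => ⟨h.1.symm, h.2 h.1.symm⟩
        · exact fun h => ⟨h.1.symm, fun _ => h.2⟩
      simp only [this, if_true, Nat.add_right_cancel_iff, Nat.add_sub_cancel]
      split_ifs <;> simp_all [mul_comm]

end Words

/-! ### The power series that counts words -/

section GeneratingFunctions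

open Polynomial

/-- The power series `1 / (1 - (l - 1 + X) x)` in `x`: runs of new points that follow a
given new point, where `X` counts loops. -/
noncomputable def runSeries (l : ℕ) : PowerSeries ℚ[X] :=
  PowerSeries.rescale (X + C ((l : ℚ) - 1)) (PowerSeries.mk 1)

/-- The series of the nonempty runs of new points in a gap between old points. -/
noncomputable def gapSeries (l : ℕ) : PowerSeries ℚ[X] :=
  (l : PowerSeries ℚ[X]) * (PowerSeries.X * runSeries l)

/-- The series of all the fillings of the gaps number `0, …, r - 1`; an empty gap `i` counts `X` if
it is a loop. -/
noncomputable def fillSeries (l : ℕ) (φ : ℕ → Prop) (r : ℕ) : PowerSeries ℚ[X] :=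
  open Classical in
  ∏ i ∈ Finset.range r, ((if φ i then PowerSeries.C X else 1) + gapSeries l)

theorem runSeries_eq (l : ℕ) :
    runSeries l = 1 + PowerSeries.C (X + C ((l : ℚ) - 1)) * (PowerSeries.X * runSeries l) := by
  ext1 n
  rcases n with _ | n
  · simp [runSeries]
  · rw [map_add, PowerSeries.coeff_C_mul, PowerSeries.coeff_succ_X_mul]
    simp [runSeries, PowerSeries.coeff_rescale, PowerSeries.coeff_one, pow_succ']

theorem coeff_runSeries_pow (l k n : ℕ) :
    PowerSeries.coeff n (runSeries l ^ (k + 1)) =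
      ((k + n).choose k : ℚ[X]) * (X + C ((l : ℚ) - 1)) ^ n := by
  rw [runSeries, ← map_pow, PowerSeries.mk_one_pow_eq_mk_choose_add, PowerSeries.coeff_rescale,
    PowerSeries.coeff_mk, mul_comm]

variable {A : Type*} [Fintype A]

/-- The power series for the words that continue a new point, and for those that continue an old
point. The hypotheses on `φ` say that the gap after the last old point is not a loop: it may be
left empty at no cost. -/
theorem loopPoly_eq_coeff (n : ℕ) : ∀ (e r : ℕ) (φ : ℕ → Prop), n = e + r →
    ((∀ i, i + 1 = r → ¬ φ i) → ∀ a : A, loopPoly φ (some a) n r =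
      PowerSeries.coeff e (runSeries (Fintype.card A) * fillSeries (Fintype.card A) φ r)) ∧
    (¬ φ r → loopPoly φ (none : Option A) n r =
      PowerSeries.coeff e (fillSeries (Fintype.card A) φ (r + 1))) := by
  classical
  induction n with
  | zero =>
    intro e r φ h
    obtain ⟨rfl, rfl⟩ : e = 0 ∧ r = 0 := by omega
    refine ⟨fun _ a => ?_, fun h0 => ?_⟩
    · simp [loopPoly_zero, fillSeries, runSeries]
    · simp [loopPoly_zero, fillSeries, h0, gapSeries]
  | succ n ih =>
    intro e r φ h
    refine ⟨fun h0 a => ?_, fun h0 => ?_⟩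
    · rw [loopPoly_succ]
      simp only [reduceCtorEq, if_false, add_zero, false_and, one_mul, Option.some.injEq]
      have hs : ∑ b : A, (if b = a then X else 1) * loopPoly φ (some b) n r =
          PowerSeries.coeff e (PowerSeries.C (X + C (((Fintype.card A : ℕ) : ℚ) - 1)) *
            (PowerSeries.X * (runSeries (Fintype.card A) * fillSeries (Fintype.card A) φ r))) := by
        rw [PowerSeries.coeff_C_mul]
        rcases e with _ | e
        · simp [loopPoly_eq_zero φ _ (show n < r by omega)]
        · rw [PowerSeries.coeff_succ_X_mul]
          simp only [((ih e r φ (by omega)).1 h0), ← Finset.sum_mul]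
          congr 1
          rw [← Finset.add_sum_erase _ _ (Finset.mem_univ a), if_pos rfl,
            Finset.sum_congr rfl (g := fun _ => (1 : ℚ[X]))
              (fun b hb => if_neg (Finset.ne_of_mem_erase hb))]
          have : 1 ≤ Fintype.card A := Fintype.card_pos_iff.mpr ⟨a⟩
          simp [Finset.card_erase_of_mem, Nat.cast_sub this]
      have ho : (if r = 0 then 0 else loopPoly φ (none : Option A) n (r - 1)) =
          PowerSeries.coeff e (fillSeries (Fintype.card A) φ r) := by
        rcases r with _ | r
        · have : e ≠ 0 := by omega
          simp [fillSeries, PowerSeries.coeff_one, this]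
        · simpa using (ih e r φ (by omega)).2 (h0 r rfl)
      rw [hs, ho, ← map_add]
      conv_rhs => rw [runSeries_eq]
      congr 1
      ring
    · rw [loopPoly_succ]
      simp only [reduceCtorEq, if_false, if_true, one_mul, true_and]
      set ψ : ℕ → Prop := fun i => φ (i + 1) with hψ
      have hs : ∑ b : A, loopPoly ψ (some b) n r =
          PowerSeries.coeff e (gapSeries (Fintype.card A) * fillSeries (Fintype.card A) ψ r) := by
        rw [gapSeries, mul_assoc, mul_assoc, ← nsmul_eq_mul, map_nsmul]
        rcases e with _ | e
        · simp [loopPoly_eq_zero ψ _ (show n < r by omega)]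
        · rw [PowerSeries.coeff_succ_X_mul]
          have h1 : ∀ i, i + 1 = r → ¬ ψ i := by rintro i rfl; exact h0
          simp [((ih e r ψ (by omega)).1 h1)]
      have ho : (if r = 0 then 0 else
          (if φ 0 then X else 1) * loopPoly ψ (none : Option A) n (r - 1)) =
          PowerSeries.coeff e ((if φ 0 then PowerSeries.C X else 1) *
            fillSeries (Fintype.card A) ψ r) := by
        rcases r with _ | r
        · have : e ≠ 0 := by omega
          simp [fillSeries, PowerSeries.coeff_one, this, h0]
        · have := (ih e r ψ (by omega)).2 h0
          split_ifs <;> simp_all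
      rw [hs, ho, ← map_add]
      congr 1
      conv_rhs => rw [fillSeries, Finset.prod_range_succ', ← fillSeries]
      ring

theorem fillSeries_eq (l : ℕ) (φ : ℕ → Prop) (r t : ℕ)
    (ht : (open Classical in ((Finset.range r).filter φ).card) = t) :
    fillSeries l φ r =
      (gapSeries l + PowerSeries.C X) ^ t * (gapSeries l + 1) ^ (r - t) := by
  classical
  rw [fillSeries, ← Finset.prod_filter_mul_prod_filter_not _ φ]
  rw [Finset.prod_congr rfl (g := fun _ => gapSeries l + PowerSeries.C X)
    (fun i hi => by rw [if_pos (Finset.mem_filter.mp hi).2, add_comm]), Finset.prod_const, ht]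
  rw [Finset.prod_congr rfl (g := fun _ => gapSeries l + 1)
    (fun i hi => by rw [if_neg (Finset.mem_filter.mp hi).2, add_comm]), Finset.prod_const]
  congr 2
  have := Finset.card_filter_add_card_filter_not (s := Finset.range r) φ
  rw [Finset.card_range, ht] at this
  omega

end GeneratingFunctions

/-! ### The coefficients of the word series -/

section Coefficients

open Polynomial

theorem coeff_runSeries_mul_gapSeries_pow (l j e : ℕ) :
    PowerSeries.coeff e (runSeries l * gapSeries l ^ j) =
      if j ≤ e then ((l : ℚ[X]) ^ j * (e.choose j : ℚ[X])) * (X + C ((l : ℚ) - 1)) ^ (e - j)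
      else 0 := by
  have h : runSeries l * gapSeries l ^ j =
      PowerSeries.C ((l : ℚ[X]) ^ j) * (PowerSeries.X ^ j * runSeries l ^ (j + 1)) := by
    rw [gapSeries, map_pow, map_natCast]; ring
  rw [h, PowerSeries.coeff_C_mul, PowerSeries.coeff_X_pow_mul']
  split_ifs with hj
  · rw [coeff_runSeries_pow, Nat.add_sub_cancel' hj, mul_assoc]
  · simp

/-- The words with `i` loops between new points, `y` filled gaps that were loops, and any number `b`
of filled gaps among the `f` gaps that were not: each sum over `b` is a value of `pHat`. -/
theorem sum_choose_mul_eq_pHat (l e f i y : ℕ) :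
    ∑ b ∈ Finset.range (f + 1), (f.choose b : ℚ) *
        (if y + b ≤ e then (l : ℚ) ^ (y + b) * e.choose (y + b) *
          (((l : ℚ) - 1) ^ (e - (y + b) - i) * (e - (y + b)).choose i) else 0) =
      if i + y ≤ e then (e.choose i : ℚ) * ((l : ℚ) ^ y / ((e - i - y).factorial : ℚ)) *
        pHat l ((f : ℤ) + y) y (e - i - y) else 0 := by
  split_ifs with hiy
  · have hr : (e.choose i : ℚ) * ((l : ℚ) ^ y / ((e - i - y).factorial : ℚ)) *
        pHat l ((f : ℤ) + y) y (e - i - y) = (e.choose i : ℚ) * (l : ℚ) ^ y *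
        (pHat l ((f : ℤ) + y) y (e - i - y) / ((e - i - y).factorial : ℚ)) := by ring
    rw [hr, pHat_div_factorial, Finset.Nat.sum_antidiagonal_eq_sum_range_succ_mk, Finset.mul_sum]
    set F : ℕ → ℚ := fun b => (f.choose b : ℚ) *
        (if y + b ≤ e then (l : ℚ) ^ (y + b) * e.choose (y + b) *
          (((l : ℚ) - 1) ^ (e - (y + b) - i) * (e - (y + b)).choose i) else 0) with hF
    have h1 : ∑ b ∈ Finset.range (f + 1), F b = ∑ b ∈ Finset.range (f + e + 1), F b := by
      refine (Finset.eventually_constant_sum (fun b hb => ?_) (by omega)).symm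
      simp [hF, Nat.choose_eq_zero_of_lt (show f < b by omega)]
    have h2 : ∑ b ∈ Finset.range (f + e + 1), F b =
        ∑ b ∈ Finset.range (e - i - y).succ, F b := by
      refine Finset.eventually_constant_sum (fun b hb => ?_) (by omega)
      rw [hF]
      dsimp only
      split_ifs with h
      · rw [Nat.choose_eq_zero_of_lt (show e - (y + b) < i by omega)]; simp
      · simp
    rw [h1, h2]
    refine Finset.sum_congr rfl fun b hb => ?_
    rw [Finset.mem_range] at hb
    have hm : (y + b + 1).multichoose (e - i - y - b) = (e - i).choose (y + b) := by
      rw [Nat.multichoose_eq, ← Nat.choose_symm (show y + b ≤ e - i by omega)]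
      congr 1 <;> omega
    have hc : e.choose (y + b) * (e - (y + b)).choose i = e.choose i * (e - i).choose (y + b) := by
      have k1 := Nat.choose_mul (n := e) (k := i + (y + b)) (s := i) (by omega)
      have k2 := Nat.choose_mul (n := e) (k := i + (y + b)) (s := y + b) (by omega)
      rw [Nat.add_sub_cancel_left] at k1
      rw [Nat.add_sub_cancel, ← Nat.choose_symm_add] at k2
      rw [← k1, ← k2]
    have hc' : (e.choose (y + b) : ℚ) * (e - (y + b)).choose i =
        e.choose i * (e - i).choose (y + b) := by exact_mod_cast hc
    simp only [hF, hm, if_pos (show y + b ≤ e by omega)]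
    rw [show e - (y + b) - i = e - i - y - b by omega, pow_add]
    linear_combination (f.choose b : ℚ) * l ^ y * l ^ b * ((l : ℚ) - 1) ^ (e - i - y - b) * hc'
  · refine Finset.sum_eq_zero fun b _ => ?_
    split_ifs with h
    · rw [Nat.choose_eq_zero_of_lt (show e - (y + b) < i by omega)]; simp
    · simp

/-- The expansion of both powers: `y` loops are destroyed, and `b` of the gaps that are not loops are
filled. -/
theorem coeff_coeff_runSeries_mul (l e t f k : ℕ) :
    (PowerSeries.coeff e (runSeries l *
      ((gapSeries l + PowerSeries.C X) ^ t * (gapSeries l + 1) ^ f))).coeff k =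
      ∑ y ∈ Finset.range (t + 1), if t - y ≤ k then (t.choose y : ℚ) *
        ∑ b ∈ Finset.range (f + 1), (f.choose b : ℚ) *
          (if y + b ≤ e then (l : ℚ) ^ (y + b) * e.choose (y + b) *
            (((l : ℚ) - 1) ^ (e - (y + b) - (k - (t - y))) *
              (e - (y + b)).choose (k - (t - y))) else 0) else 0 := by
  have h : runSeries l * ((gapSeries l + PowerSeries.C X) ^ t * (gapSeries l + 1) ^ f) =
      ∑ y ∈ Finset.range (t + 1), ∑ b ∈ Finset.range (f + 1),
        PowerSeries.C (X ^ (t - y) * (t.choose y : ℚ[X]) * (f.choose b : ℚ[X])) *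
          (runSeries l * gapSeries l ^ (y + b)) := by
    rw [add_pow, add_pow, Finset.sum_mul_sum, Finset.mul_sum]
    refine Finset.sum_congr rfl fun y _ => ?_
    rw [Finset.mul_sum]
    refine Finset.sum_congr rfl fun b _ => ?_
    simp only [map_mul, map_pow, map_natCast, one_pow, mul_one, pow_add]
    ring
  rw [h, map_sum, finsetSum_coeff]
  refine Finset.sum_congr rfl fun y _ => ?_
  rw [map_sum, finsetSum_coeff]
  have hterm : ∀ b ∈ Finset.range (f + 1), (PowerSeries.coeff e
      (PowerSeries.C (X ^ (t - y) * (t.choose y : ℚ[X]) * (f.choose b : ℚ[X])) *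
          (runSeries l * gapSeries l ^ (y + b)))).coeff k =
      if t - y ≤ k then (t.choose y : ℚ) * ((f.choose b : ℚ) *
        (if y + b ≤ e then (l : ℚ) ^ (y + b) * e.choose (y + b) *
          (((l : ℚ) - 1) ^ (e - (y + b) - (k - (t - y))) *
            (e - (y + b)).choose (k - (t - y))) else 0)) else 0 := by
    intro b _
    rw [PowerSeries.coeff_C_mul, coeff_runSeries_mul_gapSeries_pow]
    by_cases hb : y + b ≤ e
    · have e1 : X ^ (t - y) * (t.choose y : ℚ[X]) * (f.choose b : ℚ[X]) *
          ((l : ℚ[X]) ^ (y + b) * (e.choose (y + b) : ℚ[X]) *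
            (X + C ((l : ℚ) - 1)) ^ (e - (y + b))) =
          C ((t.choose y : ℚ) * (f.choose b * ((l : ℚ) ^ (y + b) * e.choose (y + b)))) *
            (X ^ (t - y) * (X + C ((l : ℚ) - 1)) ^ (e - (y + b))) := by
        simp only [C_mul, C_pow, map_natCast]; ring
      rw [if_pos hb, if_pos hb, e1, coeff_C_mul, coeff_X_pow_mul', coeff_X_add_C_pow]
      split_ifs <;> ring
    · simp [hb]
  rw [Finset.sum_congr rfl hterm]
  split_ifs
  · rw [Finset.mul_sum]
  · simp

/-- The coefficient `cCoeff` counts the words with `k` loops that insert `e + 1` new points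
into a row of `t + f` old points with `t` loops. -/
theorem coeff_coeff_eq_cCoeff (l e t f k : ℕ) :
    (PowerSeries.coeff e (runSeries l *
      ((gapSeries l + PowerSeries.C X) ^ t * (gapSeries l + 1) ^ f))).coeff k =
      cCoeff l (e + 1) (t + f + (e + 1)) k t := by
  -- `y` destroyed loops and `i` loops between new points leave `t - y + i` loops.
  set h : ℕ → ℕ → ℚ := fun y i => (t.choose y : ℚ) *
    (if i + y ≤ e then (e.choose i : ℚ) * ((l : ℚ) ^ y / ((e - i - y).factorial : ℚ)) *
        pHat l ((f : ℤ) + y) y (e - i - y) else 0) with hh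
  have hL : (PowerSeries.coeff e (runSeries l *
      ((gapSeries l + PowerSeries.C X) ^ t * (gapSeries l + 1) ^ f))).coeff k =
      ∑ y ∈ Finset.range (t + 1), ∑ i ∈ Finset.range (e + 1),
        if k + y = t + i then h y i else 0 := by
    rw [coeff_coeff_runSeries_mul]
    refine Finset.sum_congr rfl fun y hy => ?_
    rw [Finset.mem_range] at hy
    simp only [sum_choose_mul_eq_pHat]
    change (if t - y ≤ k then h y (k - (t - y)) else 0) = _
    by_cases h1 : t - y ≤ k
    · rw [if_pos h1]
      by_cases h2 : k - (t - y) ≤ e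
      · rw [Finset.sum_eq_single (k - (t - y)), if_pos (by omega)]
        · intro i _ hi
          exact if_neg (by omega)
        · intro hi
          rw [Finset.mem_range] at hi
          omega
      · rw [hh]
        dsimp only
        rw [if_neg (by omega), mul_zero]
        refine (Finset.sum_eq_zero fun i hi => if_neg ?_).symm
        rw [Finset.mem_range] at hi
        omega
    · rw [if_neg h1]
      exact (Finset.sum_eq_zero fun i _ => if_neg (by omega)).symm
  rw [hL, Finset.sum_comm, cCoeff]
  refine Finset.sum_congr rfl fun i hi => ?_
  by_cases h1 : k ≤ t + i ∧ t + i - k ≤ t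
  · rw [Finset.sum_eq_single (t + i - k), if_pos (by omega), hh]
    · dsimp only
      by_cases h2 : i + (t + i - k) ≤ e
      · rw [if_pos h2, if_pos (by omega)]
        have e1 : e + 1 + k - (2 * i + t + 1) = e - i - (t + i - k) := by omega
        have e2 : ((t + f + (e + 1) : ℕ) : ℤ) - (e + 1 : ℕ) - ((k : ℤ) - i) =
            f + ((t + i - k : ℕ) : ℤ) := by push_cast [Nat.cast_sub h1.1]; ring
        rw [e1, e2, Nat.add_sub_cancel]
        ring
      · rw [if_neg h2, if_neg (by omega), mul_zero]
    · intro y _ hy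
      exact if_neg (by omega)
    · intro hy
      rw [Finset.mem_range] at hy
      omega
  · rw [Finset.sum_eq_zero]
    · split_ifs with h2
      · rw [Nat.choose_eq_zero_of_lt (show t < t + i - k by omega)]; simp
      · rfl
    · intro y hy
      rw [Finset.mem_range] at hy
      exact if_neg (by omega)

theorem cCoeff_eq_zero {l e v k t : ℕ} (h : t + e < k + 1 ∨ k + e < t + 1) :
    cCoeff l e v k t = 0 := by
  refine Finset.sum_eq_zero fun i hi => if_neg ?_
  rw [Finset.mem_range] at hi
  omega

end Coefficients

/-! ### The old positions of a word -/

section OldPoints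

variable {A : Type*}

/-- The positions of the old letters of a word. -/
def oldSet {n : ℕ} (f : Fin n → Option A) : Finset (Fin n) :=
  open Classical in Finset.univ.filter fun j => f j = none

theorem mem_oldSet {n : ℕ} {f : Fin n → Option A} {j : Fin n} : j ∈ oldSet f ↔ f j = none := by
  simp [oldSet]

theorem apply_orderEmbOfFin_oldSet {n w : ℕ} (f : Fin n → Option A) (hf : (oldSet f).card = w)
    (i : Fin w) : f ((oldSet f).orderEmbOfFin hf i) = none :=
  mem_oldSet.mp (Finset.orderEmbOfFin_mem _ _ _)

theorem exists_orderEmbOfFin_eq {n w : ℕ} {f : Fin n → Option A} (hf : (oldSet f).card = w)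
    {j : Fin n} (hj : f j = none) : ∃ i, (oldSet f).orderEmbOfFin hf i = j := by
  have : j ∈ Set.range ((oldSet f).orderEmbOfFin hf) := by
    rw [Finset.range_orderEmbOfFin]; exact mem_oldSet.mpr hj
  exact this

theorem oldBefore_orderEmbOfFin {n w : ℕ} (f : Fin n → Option A) (hf : (oldSet f).card = w)
    (i : Fin w) : oldBefore f ((oldSet f).orderEmbOfFin hf i) = i := by
  classical
  rw [← Fin.card_Iio i, ← Finset.card_map ((oldSet f).orderEmbOfFin hf).toEmbedding, oldBefore]
  congr 1
  ext k
  simp only [Finset.mem_filter, Finset.mem_univ, true_and, Finset.mem_map, Finset.mem_Iio]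
  constructor
  · rintro ⟨h1, h2⟩
    obtain ⟨i', rfl⟩ := exists_orderEmbOfFin_eq hf h2
    exact ⟨i', by simpa using h1, rfl⟩
  · rintro ⟨i', h1, rfl⟩
    exact ⟨by simpa using h1, apply_orderEmbOfFin_oldSet f hf i'⟩

end OldPoints

/-! ### Gluing a word to a smaller diagram -/

section Glue

variable {m : ℕ} {A : Type*} [AddCommGroup A] (π : ZMod m →+ A)

open Classical in
/-- A label of the clique of each point of the diagram `glue π f hf r`. -/
noncomputable def glueMap {n w : ℕ} (f : Fin n → Option A) (hf : (oldSet f).card = w)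
    (r : Setoid (SectorPoint m w)) (p : SectorPoint m n) : A ⊕ Quotient r :=
  if h : p.2 ∈ oldSet f then
    .inr (Quotient.mk r (p.1, ((oldSet f).orderIsoOfFin hf).symm ⟨p.2, h⟩))
  else .inl (π p.1 - (f p.2).getD 0)

/-- The diagram obtained from the diagram `r` on the old points by inserting new points according to
the word `f`: the new point at position `j` of sector `s` with colour `c` belongs to the
clique number `π s - c`. -/
noncomputable def glue {n w : ℕ} (f : Fin n → Option A) (hf : (oldSet f).card = w)
    (r : Setoid (SectorPoint m w)) : Setoid (SectorPoint m n) :=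
  Setoid.ker (glueMap π f hf r)

variable {n w : ℕ} {f : Fin n → Option A} (hf : (oldSet f).card = w) (r : Setoid (SectorPoint m w))

theorem glueMap_old (s : ZMod m) (i : Fin w) :
    glueMap π f hf r (s, (oldSet f).orderEmbOfFin hf i) = .inr (Quotient.mk r (s, i)) := by
  rw [glueMap, dif_pos (Finset.orderEmbOfFin_mem _ _ _)]
  congr 3
  rw [OrderIso.symm_apply_eq]
  rfl

theorem glueMap_new (s : ZMod m) {j : Fin n} {c : A} (hj : f j = some c) :
    glueMap π f hf r (s, j) = .inl (π s - c) := by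
  rw [glueMap, dif_neg (by simp [mem_oldSet, hj])]
  simp [hj]

theorem glue_old_old (s s' : ZMod m) (i i' : Fin w) :
    glue π f hf r (s, (oldSet f).orderEmbOfFin hf i) (s', (oldSet f).orderEmbOfFin hf i') ↔
      r (s, i) (s', i') := by
  rw [glue, Setoid.ker_def, glueMap_old, glueMap_old, Sum.inr.injEq]
  exact Quotient.eq

theorem glue_new_new (s s' : ZMod m) {j j' : Fin n} {c c' : A} (hj : f j = some c)
    (hj' : f j' = some c') : glue π f hf r (s, j) (s', j') ↔ π s - c = π s' - c' := by
  rw [glue, Setoid.ker_def, glueMap_new π hf r s hj, glueMap_new π hf r s' hj', Sum.inl.injEq]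

theorem not_glue_new_old (s s' : ZMod m) {j : Fin n} {c : A} (hj : f j = some c) (i : Fin w) :
    ¬ glue π f hf r (s, j) (s', (oldSet f).orderEmbOfFin hf i) := by
  rw [glue, Setoid.ker_def, glueMap_new π hf r s hj, glueMap_old]
  simp

theorem not_glue_old_new (s s' : ZMod m) {j : Fin n} {c : A} (hj : f j = some c) (i : Fin w) :
    ¬ glue π f hf r (s', (oldSet f).orderEmbOfFin hf i) (s, j) :=
  fun h => not_glue_new_old π hf r s s' hj i ((glue π f hf r).symm h)

theorem glue_old_class (s : ZMod m) (i : Fin w) :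
    {q | glue π f hf r q (s, (oldSet f).orderEmbOfFin hf i)} =
      Prod.map id ((oldSet f).orderEmbOfFin hf) '' {q | r q (s, i)} := by
  ext ⟨s', j⟩
  rcases hj : f j with _ | c
  · obtain ⟨i', rfl⟩ := exists_orderEmbOfFin_eq hf hj
    simp only [Set.mem_ofPred_eq, glue_old_old, Set.mem_image, Prod.exists, Prod.map_apply, id_eq,
      Prod.mk.injEq]
    constructor
    · exact fun h => ⟨s', i', h, rfl, rfl⟩
    · rintro ⟨s1, i1, h, rfl, h2⟩
      rwa [← ((oldSet f).orderEmbOfFin hf).injective h2]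
  · simp only [Set.mem_ofPred_eq, not_glue_new_old π hf r s' s hj i, false_iff]
    rintro ⟨⟨s1, i1⟩, -, h⟩
    have h2 : (oldSet f).orderEmbOfFin hf i1 = j := congrArg Prod.snd h
    have := apply_orderEmbOfFin_oldSet f hf i1
    rw [h2, hj] at this
    cases this

theorem ncard_glue_old_class (s : ZMod m) (i : Fin w) :
    {q | glue π f hf r q (s, (oldSet f).orderEmbOfFin hf i)}.ncard = {q | r q (s, i)}.ncard := by
  rw [glue_old_class]
  exact Set.ncard_image_of_injective _
    (Function.injective_id.prodMap ((oldSet f).orderEmbOfFin hf).injective)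

/-- `oldLoop r i` says that the points `i` and `i + 1` of the sector `0` form a loop of `r`. -/
def oldLoop (r : Setoid (SectorPoint m w)) (i : ℕ) : Prop :=
  ∃ h : i < w, (⟨i, h⟩ : Fin w) ∈ sectorLoops r 0

theorem ncard_sectorLoops_glue :
    (sectorLoops (glue π f hf r) 0).ncard = wordLoops (oldLoop r) f := by
  classical
  rw [wordLoops, ← Set.ncard_coe_finset]
  congr 1
  ext j
  rw [Finset.mem_coe, Finset.mem_filter]
  simp only [sectorLoops, Set.mem_ofPred_eq, Finset.mem_univ, true_and, IsWordLoop]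
  refine exists_congr fun h => ?_
  rcases hj : f j with _ | c <;> rcases hj' : f ⟨j + 1, h⟩ with _ | c'
  · obtain ⟨i, hi⟩ := exists_orderEmbOfFin_eq hf hj
    obtain ⟨i', hi'⟩ := exists_orderEmbOfFin_eq hf hj'
    have hii : (i' : ℕ) = i + 1 := by
      have h1 : i < i' := by
        rw [← ((oldSet f).orderEmbOfFin hf).lt_iff_lt, hi, hi', Fin.lt_def]
        simp
      by_contra hne
      have h2 : i < (⟨i + 1, by omega⟩ : Fin w) := by simp [Fin.lt_def]
      have h3 : (⟨i + 1, by omega⟩ : Fin w) < i' := by simp only [Fin.lt_def]; omega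
      rw [← ((oldSet f).orderEmbOfFin hf).lt_iff_lt, Fin.lt_def] at h2 h3
      rw [hi] at h2
      rw [hi'] at h3
      simp only at h3
      omega
    have hw : (i : ℕ) + 1 < w := by omega
    obtain rfl : i' = ⟨i + 1, hw⟩ := Fin.ext hii
    rw [← hi', ← hi, glue_old_old, oldBefore_orderEmbOfFin]
    simp only [true_and, true_implies, oldLoop, sectorLoops, Set.mem_ofPred_eq, Fin.is_lt,
      Fin.eta, exists_prop, hw, exists_true_left]
  · obtain ⟨i, hi⟩ := exists_orderEmbOfFin_eq hf hj
    have := not_glue_old_new π hf r 0 0 hj' i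
    rw [hi] at this
    simp [this]
  · obtain ⟨i', hi'⟩ := exists_orderEmbOfFin_eq hf hj'
    rw [← hi']
    simp [not_glue_new_old π hf r _ _ hj i']
  · rw [glue_new_new π hf r _ _ hj hj']
    simp [eq_comm]

theorem card_oldLoop {w : ℕ} (r : Setoid (SectorPoint m w)) :
    (open Classical in ((Finset.range w).filter (oldLoop r)).card) = (sectorLoops r 0).ncard := by
  classical
  rw [← Set.ncard_image_of_injective _ Fin.val_injective, ← Set.ncard_coe_finset]
  congr 1
  ext i
  simp only [Finset.coe_filter, Finset.mem_range, Set.mem_ofPred_eq, oldLoop, Set.mem_image]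
  constructor
  · rintro ⟨-, h, hi⟩
    exact ⟨⟨i, h⟩, hi, rfl⟩
  · rintro ⟨j, hj, rfl⟩
    exact ⟨j.2, j.2, hj⟩

theorem not_oldLoop_last {w : ℕ} (r : Setoid (SectorPoint m w)) (i : ℕ) (hi : i + 1 = w) :
    ¬ oldLoop r i := by
  rintro ⟨h, h1, -⟩
  simp only at h1
  omega

theorem ncard_fiber_eq (hπ : Function.Surjective π) (x : A) :
    {s | π s = x}.ncard = {s | π s = 0}.ncard := by
  obtain ⟨s0, rfl⟩ := hπ x
  refine Set.ncard_congr (fun s _ => s - s0) ?_ ?_ ?_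
  · intro s hs
    simpa [sub_eq_zero] using hs
  · intro s s' _ _ h
    exact sub_left_injective h
  · intro s hs
    refine ⟨s + s0, ?_, by simp⟩
    simpa using hs

variable [NeZero m]

/-- At each new position, the sectors in which a given clique has its points form a fibre
of `π`. -/
theorem ncard_glue_new_class (hπ : Function.Surjective π) (s : ZMod m) {j : Fin n} {c : A}
    (hj : f j = some c) :
    {q | glue π f hf r q (s, j)}.ncard = (n - w) * {s | π s = 0}.ncard := by
  classical
  have h1 : {q | glue π f hf r q (s, j)} = (Finset.univ.filter fun q : SectorPoint m n =>
      ∃ c', f q.2 = some c' ∧ π q.1 = π s - c + c' : Finset (SectorPoint m n)) := by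
    ext ⟨s', j'⟩
    simp only [Set.mem_ofPred_eq, Finset.coe_filter, Finset.mem_univ, true_and]
    rcases hj' : f j' with _ | c'
    · obtain ⟨i', rfl⟩ := exists_orderEmbOfFin_eq hf hj'
      simp [not_glue_old_new π hf r s s' hj i']
    · rw [glue_new_new π hf r s' s hj' hj]
      simp [sub_eq_iff_eq_add]
  rw [h1, Set.ncard_coe_finset, Finset.card_filter, Fintype.sum_prod_type_right]
  have h2 : ∀ j' : Fin n, (∑ s' : ZMod m,
      if ∃ c', f j' = some c' ∧ π s' = π s - c + c' then 1 else 0) =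
      if j' ∈ oldSet f then 0 else {s | π s = 0}.ncard := by
    intro j'
    rw [← Finset.card_filter, ← Set.ncard_coe_finset]
    rcases hj' : f j' with _ | c'
    · simp [mem_oldSet, hj']
    · rw [if_neg (by simp [mem_oldSet, hj']), ← ncard_fiber_eq π hπ (π s - c + c')]
      simp
  simp only [h2]
  rw [Finset.sum_ite, Finset.sum_const_zero, zero_add, Finset.sum_const, smul_eq_mul]
  congr 1
  have := Finset.card_filter_add_card_filter_not (s := (Finset.univ : Finset (Fin n)))
    (fun j => j ∈ oldSet f)
  rw [Finset.card_univ, Fintype.card_fin, Finset.filter_mem_eq_inter, Finset.univ_inter, hf] at this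
  omega

theorem isMLinearDiagram_glue (hπ : Function.Surjective π) {d : ℕ}
    (hr : IsMLinearDiagram m d w r)
    (hd : (n - w) * {s | π s = 0}.ncard = d) :
    IsMLinearDiagram m d n (glue π f hf r) where
  clique_card := by
    rintro ⟨s, j⟩
    rcases hj : f j with _ | c
    · obtain ⟨i, rfl⟩ := exists_orderEmbOfFin_eq hf hj
      rw [ncard_glue_old_class, hr.clique_card]
    · rw [ncard_glue_new_class π hf r hπ s hj, hd]
  symmetric := by
    rintro ⟨s, j⟩ ⟨s', j'⟩
    simp only [sectorRotation]
    rcases hj : f j with _ | c <;> rcases hj' : f j' with _ | c'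
    · obtain ⟨i, rfl⟩ := exists_orderEmbOfFin_eq hf hj
      obtain ⟨i', rfl⟩ := exists_orderEmbOfFin_eq hf hj'
      rw [glue_old_old, glue_old_old]
      exact hr.symmetric (s, i) (s', i')
    · obtain ⟨i, rfl⟩ := exists_orderEmbOfFin_eq hf hj
      simp [not_glue_old_new π hf r _ _ hj' i]
    · obtain ⟨i', rfl⟩ := exists_orderEmbOfFin_eq hf hj'
      simp [not_glue_new_old π hf r _ _ hj i']
    · rw [glue_new_new π hf r _ _ hj hj', glue_new_new π hf r _ _ hj hj', map_add, map_add,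
        add_sub_right_comm, add_sub_right_comm, add_left_inj]

end Glue

/-! ### Splitting off the orbit of the first clique -/

section Decomposition

variable {m : ℕ} {A : Type*} [AddCommGroup A] (π : ZMod m →+ A) {n : ℕ}

/-- The clique of the first point meets the first points of exactly those sectors
that lie in the kernel of `π`. -/
def HasStabilizer (r : Setoid (SectorPoint m (n + 1))) : Prop :=
  ∀ g, r (g, 0) (0, 0) ↔ π g = 0

theorem hasStabilizer_glue {w : ℕ} {f : Fin (n + 1) → Option A} (hf : (oldSet f).card = w)
    (r' : Setoid (SectorPoint m w)) (h0 : f 0 = some 0) : HasStabilizer π (glue π f hf r') := by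
  intro g
  rw [glue_new_new π hf r' g 0 h0 h0]
  simp

theorem glue_apply_zero_iff {w : ℕ} {f : Fin (n + 1) → Option A} (hf : (oldSet f).card = w)
    (r' : Setoid (SectorPoint m w)) (h0 : f 0 = some 0) (s : ZMod m) (j : Fin (n + 1)) :
    glue π f hf r' (s, j) (0, 0) ↔ f j = some (π s) := by
  rcases hj : f j with _ | c
  · obtain ⟨i, rfl⟩ := exists_orderEmbOfFin_eq hf hj
    simp [not_glue_old_new π hf r' 0 s h0 i]
  · rw [glue_new_new π hf r' s 0 hj h0]
    rw [map_zero, sub_self, sub_eq_zero, Option.some.injEq, eq_comm]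

theorem glue_injective (hπ : Function.Surjective π) {w : ℕ} {f f' : Fin (n + 1) → Option A}
    (hf : (oldSet f).card = w) (hf' : (oldSet f').card = w) (r r' : Setoid (SectorPoint m w))
    (h0 : f 0 = some 0) (h0' : f' 0 = some 0) (h : glue π f hf r = glue π f' hf' r') :
    f = f' ∧ r = r' := by
  have hff : f = f' := by
    funext j
    refine Option.ext fun c => ?_
    obtain ⟨s, rfl⟩ := hπ c
    rw [← glue_apply_zero_iff π hf r h0, ← glue_apply_zero_iff π hf' r' h0', h]
  subst hff
  refine ⟨rfl, Setoid.ext fun p q => ?_⟩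
  rw [← glue_old_old π hf r p.1 q.1 p.2 q.2, h, glue_old_old]

variable {d : ℕ} [NeZero m]

theorem IsMLinearDiagram.translate {r : Setoid (SectorPoint m n)}
    (hr : IsMLinearDiagram m d n r) (g s s' : ZMod m) (j j' : Fin n) :
    r (s + g, j) (s' + g, j') ↔ r (s, j) (s', j') := by
  have h : ∀ k : ℕ, r (s + k, j) (s' + k, j') ↔ r (s, j) (s', j') := by
    intro k
    induction k with
    | zero => simp
    | succ k ih =>
      rw [← ih, ← hr.symmetric (s + k, j)]
      simp [sectorRotation, add_assoc]
  rw [← h g.val, ZMod.natCast_zmod_val]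

theorem IsMLinearDiagram.sectorLoops_eq {r : Setoid (SectorPoint m n)}
    (hr : IsMLinearDiagram m d n r) (s : ZMod m) : sectorLoops r s = sectorLoops r 0 := by
  ext j
  refine exists_congr fun h => ?_
  have := hr.translate s 0 0 j ⟨j + 1, h⟩
  rwa [zero_add] at this

open Classical in
/-- The word of a diagram: the positions of the points in the orbit of the clique of the first
point, each coloured by the clique that it belongs to. -/
noncomputable def colourWord (r : Setoid (SectorPoint m (n + 1))) :
    Fin (n + 1) → Option A := fun j =>
  if h : ∃ s, r (s, j) (0, 0) then some (π h.choose) else none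

variable {r : Setoid (SectorPoint m (n + 1))}

/-- The colour of a position does not depend on the sector in which the clique of the first point
is met. -/
theorem colourWord_eq_some_iff (hr : IsMLinearDiagram m d (n + 1) r) (hs : HasStabilizer π r)
    (s : ZMod m) (j : Fin (n + 1)) : colourWord π r j = some (π s) ↔ r (s, j) (0, 0) := by
  have key : ∀ s', r (s', j) (0, 0) → (r (s, j) (0, 0) ↔ π s' = π s) := by
    intro s' h'
    have h1 := (hr.translate (s - s') s' 0 j 0).mpr h'
    rw [add_sub_cancel, zero_add] at h1
    have h2 : r (s, j) (0, 0) ↔ r (s - s', 0) (0, 0) :=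
      ⟨fun h => r.trans (r.symm h1) h, fun h => r.trans h1 h⟩
    rw [h2, hs, map_sub, sub_eq_zero, eq_comm]
  rw [colourWord]
  split_ifs with h
  · rw [Option.some.injEq, key _ h.choose_spec]
  · simp only [false_iff]
    exact fun h' => h ⟨s, h'⟩

theorem colourWord_zero (hr : IsMLinearDiagram m d (n + 1) r) (hs : HasStabilizer π r) :
    colourWord π r 0 = some 0 := by
  rw [← map_zero π, colourWord_eq_some_iff π hr hs]

/-- A diagram is recovered from its word and the diagram that its other points form. -/
theorem glue_colourWord (hπ : Function.Surjective π) (hr : IsMLinearDiagram m d (n + 1) r)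
    (hs : HasStabilizer π r) {w : ℕ} (hf : (oldSet (colourWord π r)).card = w) :
    glue π (colourWord π r) hf
      (r.comap (Prod.map id ((oldSet (colourWord π r)).orderEmbOfFin hf))) = r := by
  set r' := r.comap (Prod.map id ((oldSet (colourWord π r)).orderEmbOfFin hf)) with hr'
  -- A new point of colour `π s₀` in sector `s` lies in the clique of the first point of `s - s₀`.
  have hnew : ∀ s s₀ j, colourWord π r j = some (π s₀) → r (s, j) (s - s₀, 0) := by
    intro s s₀ j h
    have := (hr.translate (s - s₀) s₀ 0 j 0).mpr ((colourWord_eq_some_iff π hr hs s₀ j).mp h)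
    rwa [add_sub_cancel, zero_add] at this
  have hno : ∀ s s' j j' c, colourWord π r j = some c → colourWord π r j' = none →
      ¬ r (s, j) (s', j') := by
    intro s s' j j' c hj hj' h
    obtain ⟨s₀, rfl⟩ := hπ c
    have h1 := (hr.translate (-(s - s₀)) s' (s - s₀) j' 0).mpr
      (r.trans (r.symm h) (hnew s s₀ j hj))
    rw [add_neg_cancel, ← colourWord_eq_some_iff π hr hs, hj'] at h1
    cases h1
  ext ⟨s, j⟩ ⟨s', j'⟩
  rcases hj : colourWord π r j with _ | c <;> rcases hj' : colourWord π r j' with _ | c'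
  · obtain ⟨i, rfl⟩ := exists_orderEmbOfFin_eq hf hj
    obtain ⟨i', rfl⟩ := exists_orderEmbOfFin_eq hf hj'
    rw [glue_old_old]
    rfl
  · have h1 := hno s' s j' j c' hj' hj
    obtain ⟨i, rfl⟩ := exists_orderEmbOfFin_eq hf hj
    exact iff_of_false (not_glue_old_new π hf r' s' s hj' i) fun h => h1 (r.symm h)
  · have h1 := hno s s' j j' c hj hj'
    obtain ⟨i', rfl⟩ := exists_orderEmbOfFin_eq hf hj'
    exact iff_of_false (not_glue_new_old π hf r' s s' hj i') h1
  · rw [glue_new_new π hf r' s s' hj hj']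
    obtain ⟨s₀, rfl⟩ := hπ c
    obtain ⟨s₁, rfl⟩ := hπ c'
    have h1 := hnew s s₀ j hj
    have h2 := hnew s' s₁ j' hj'
    have h3 : r (s, j) (s', j') ↔ r (s - s₀, 0) (s' - s₁, 0) :=
      ⟨fun h => r.trans (r.symm h1) (r.trans h h2), fun h => r.trans h1 (r.trans h (r.symm h2))⟩
    have h4 := hr.translate (-(s' - s₁)) (s - s₀) (s' - s₁) 0 0
    rw [add_neg_cancel] at h4
    rw [h3, ← h4, hs, map_add, map_neg, map_sub, map_sub, add_neg_eq_zero]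

theorem isMLinearDiagram_comap (hπ : Function.Surjective π) (hr : IsMLinearDiagram m d (n + 1) r)
    (hs : HasStabilizer π r) {w : ℕ} (hf : (oldSet (colourWord π r)).card = w) :
    IsMLinearDiagram m d w
      (r.comap (Prod.map id ((oldSet (colourWord π r)).orderEmbOfFin hf))) where
  clique_card := by
    rintro ⟨s, i⟩
    rw [← ncard_glue_old_class π hf, glue_colourWord π hπ hr hs, hr.clique_card]
  symmetric := fun p q => hr.symmetric (p.1, _) (q.1, _)

/-- The clique of the first point, counted by positions. -/
theorem card_colourWord (hπ : Function.Surjective π) (hr : IsMLinearDiagram m d (n + 1) r)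
    (hs : HasStabilizer π r) :
    (n + 1 - (oldSet (colourWord π r)).card) *
      {s | π s = 0}.ncard = d := by
  rw [← ncard_glue_new_class π rfl (r.comap (Prod.map id ((oldSet (colourWord π r)).orderEmbOfFin
    rfl))) hπ 0 (colourWord_zero π hr hs), glue_colourWord π hπ hr hs, hr.clique_card]

end Decomposition

/-! ### Counting the diagrams with a given stabilizer -/

section Counting

open Classical in
/-- The number of words with first letter `a` that insert new points into a row of `w`
old points with `t` loops, such that `k` loops result. -/
theorem card_words {A : Type*} [Fintype A] (a : A) {n e w t k : ℕ} (hn : e + w = n + 1)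
    (he : 1 ≤ e) (φ : ℕ → Prop) (hφ : ∀ i, i + 1 = w → ¬ φ i)
    (ht : ((Finset.range w).filter φ).card = t) :
    ((Finset.univ.filter fun f : Fin (n + 1) → Option A =>
      f 0 = some a ∧ (oldSet f).card = w ∧ wordLoops φ f = k).card : ℚ) =
      cCoeff (Fintype.card A) e (n + 1) k t := by
  obtain ⟨e, rfl⟩ : ∃ e', e = e' + 1 := ⟨e - 1, by omega⟩
  have htw : t ≤ w := by
    rw [← ht]
    simpa using Finset.card_filter_le (Finset.range w) φ
  have h1 := coeff_coeff_eq_cCoeff (Fintype.card A) e t (w - t) k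
  rw [show t + (w - t) + (e + 1) = n + 1 by omega, ← fillSeries_eq _ φ w t ht,
    ← (loopPoly_eq_coeff n e w φ (by omega)).1 hφ a] at h1
  rw [← h1, loopPoly, Polynomial.finsetSum_coeff]
  have h2 : ((Finset.univ.filter fun f : Fin (n + 1) → Option A =>
      f 0 = some a ∧ (oldSet f).card = w ∧ wordLoops φ f = k)).card =
      ((Finset.univ.filter fun g : Fin n → Option A =>
        (Finset.univ.filter fun j => g j = none).card = w ∧
          wordLoops φ (Fin.cons (some a) g : Fin (n + 1) → Option A) = k)).card := by
    symm
    have ho : ∀ g : Fin n → Option A,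
        (oldSet (Fin.cons (some a) g : Fin (n + 1) → Option A)).card =
          (Finset.univ.filter fun j => g j = none).card := by
      intro g
      rw [oldSet, Fin.card_filter_univ_succ]
      simp
    refine Finset.card_bij (fun g _ => Fin.cons (some a) g) ?_ ?_ ?_
    · intro g hg
      simp only [Finset.mem_filter, Finset.mem_univ, true_and] at hg ⊢
      exact ⟨rfl, (ho g).trans hg.1, hg.2⟩
    · intro g _ g' _ h
      exact (Fin.cons_injective2 h).2
    · intro f hf
      simp only [Finset.mem_filter, Finset.mem_univ, true_and] at hf
      have hcons : (Fin.cons (some a) (Fin.tail f) : Fin (n + 1) → Option A) = f := by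
        rw [← hf.1, Fin.cons_self_tail]
      refine ⟨Fin.tail f, ?_, hcons⟩
      simp only [Finset.mem_filter, Finset.mem_univ, true_and]
      rw [← ho, hcons]
      exact hf.2
  rw [h2, Finset.card_filter, Nat.cast_sum]
  refine Finset.sum_congr rfl fun g _ => ?_
  by_cases hg : (Finset.univ.filter fun j => g j = none).card = w
  · simp [hg, Polynomial.coeff_X_pow, eq_comm]
  · simp [hg]

instance {α : Type*} [Finite α] : Finite (Setoid α) :=
  Finite.of_injective (fun r : Setoid α => r.r) fun r r' h => Setoid.ext fun a b => by
    rw [show r.r = r'.r from h]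

variable {m d : ℕ} [NeZero m] {A : Type*} [AddCommGroup A] (π : ZMod m →+ A)

/-- The number of diagrams with `k` loops per sector and a given stabilizer of the clique of the
first point. -/
theorem ncard_hasStabilizer [Fintype A] (hπ : Function.Surjective π) {n e w k : ℕ}
    (hn : e + w = n + 1) (he : 1 ≤ e)
    (hd : e * {s | π s = 0}.ncard = d)
    (hd0 : 1 ≤ d) :
    ({r : Setoid (SectorPoint m (n + 1)) | IsMLinearDiagram m d (n + 1) r ∧
        (∀ s, (sectorLoops r s).ncard = k) ∧ HasStabilizer π r}.ncard : ℚ) =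
      ∑ t ∈ Finset.range (w + 1),
        cCoeff (Fintype.card A) e (n + 1) k t * (numMLinear m d w t : ℚ) := by
  classical
  have : Fintype {r : Setoid (SectorPoint m w) // IsMLinearDiagram m d w r} := Fintype.ofFinite _
  -- Gluing is a bijection from the pairs of a smaller diagram and a word that yields `k` loops.
  let F : (Σ r : {r : Setoid (SectorPoint m w) // IsMLinearDiagram m d w r},
      {f : Fin (n + 1) → Option A //
        f 0 = some 0 ∧ (oldSet f).card = w ∧ wordLoops (oldLoop r.1) f = k}) →
      {r : Setoid (SectorPoint m (n + 1)) | IsMLinearDiagram m d (n + 1) r ∧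
        (∀ s, (sectorLoops r s).ncard = k) ∧ HasStabilizer π r} := fun p => by
    have hD := isMLinearDiagram_glue π p.2.2.2.1 p.1.1 hπ p.1.2
        (by rw [show n + 1 - w = e by omega]; exact hd)
    exact ⟨glue π p.2.1 p.2.2.2.1 p.1.1, hD, fun s => by
      rw [hD.sectorLoops_eq, ncard_sectorLoops_glue, p.2.2.2.2],
      hasStabilizer_glue π p.2.2.2.1 p.1.1 p.2.2.1⟩
  have hF : Function.Bijective F := by
    constructor
    · rintro ⟨⟨r, hr⟩, ⟨f, h0, hf, hk⟩⟩ ⟨⟨r', hr'⟩, ⟨f', h0', hf', hk'⟩⟩ h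
      obtain ⟨rfl, rfl⟩ := glue_injective π hπ hf hf' r r' h0 h0' (congrArg Subtype.val h)
      rfl
    · rintro ⟨r, hr, hk, hs⟩
      have hcard := card_colourWord π hπ hr hs
      have hf : (oldSet (colourWord π r)).card = w := by
        have hK : 0 < {s | π s = 0}.ncard := by
          refine Nat.pos_of_ne_zero fun h0 => ?_
          rw [h0] at hd
          omega
        have h1 := Nat.eq_of_mul_eq_mul_right hK (hcard.trans hd.symm)
        have h2 := Finset.card_le_univ (oldSet (colourWord π r))
        rw [Fintype.card_fin] at h2
        omega
      refine ⟨⟨⟨_, isMLinearDiagram_comap π hπ hr hs hf⟩,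
        ⟨colourWord π r, colourWord_zero π hr hs, hf, ?_⟩⟩, ?_⟩
      · rw [← ncard_sectorLoops_glue π hf, glue_colourWord π hπ hr hs]
        exact hk 0
      · exact Subtype.ext (glue_colourWord π hπ hr hs hf)
  rw [← Nat.card_coe_set_eq, ← Nat.card_congr (Equiv.ofBijective F hF), Nat.card_sigma,
    Nat.cast_sum]
  have hc : ∀ r : {r : Setoid (SectorPoint m w) // IsMLinearDiagram m d w r},
      (Nat.card {f : Fin (n + 1) → Option A //
        f 0 = some 0 ∧ (oldSet f).card = w ∧ wordLoops (oldLoop r.1) f = k} : ℚ) =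
      cCoeff (Fintype.card A) e (n + 1) k (sectorLoops r.1 0).ncard := by
    intro r
    rw [← card_words 0 hn he (oldLoop r.1) (not_oldLoop_last r.1) (card_oldLoop r.1),
      Nat.card_eq_fintype_card, Fintype.card_subtype]
  simp only [hc]
  rw [← Finset.sum_fiberwise_of_maps_to (s := Finset.univ) (t := Finset.range (w + 1))
    (g := fun r : {r : Setoid (SectorPoint m w) // IsMLinearDiagram m d w r} =>
      (sectorLoops r.1 0).ncard)]
  · refine Finset.sum_congr rfl fun t _ => ?_
    rw [Finset.sum_congr rfl (g := fun _ => cCoeff (Fintype.card A) e (n + 1) k t)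
      (fun r hr => by rw [(Finset.mem_filter.mp hr).2]), Finset.sum_const, nsmul_eq_mul, mul_comm]
    congr 2
    rw [numMLinear, ← Set.ncard_coe_finset,
      ← Set.ncard_image_of_injective _ Subtype.val_injective]
    congr 1
    ext r
    simp only [Finset.coe_filter, Finset.mem_univ, true_and, Set.mem_image, Set.mem_ofPred_eq,
      Subtype.exists, exists_and_left, exists_prop, exists_eq_right_right]
    constructor
    · rintro ⟨h1, h2⟩
      exact ⟨h2, fun s => by rw [h2.sectorLoops_eq, h1]⟩
    · rintro ⟨h1, h2⟩
      exact ⟨h2 0, h1⟩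
  · intro r _
    rw [Finset.mem_range, Nat.lt_succ_iff]
    exact (Set.ncard_le_card _).trans (by simp)

end Counting

/-! ### The size of the orbit of the first clique -/

section Assembly

theorem numMLinear_eq_zero {m d w t : ℕ} (h : w < t) : numMLinear m d w t = 0 := by
  rw [numMLinear, ← Set.ncard_empty (Setoid (SectorPoint m w))]
  congr 1
  refine Set.eq_empty_iff_forall_notMem.mpr ?_
  rintro r ⟨-, hr⟩
  have h1 := Set.ncard_le_card (sectorLoops r 0)
  rw [hr 0, Nat.card_fin] at h1
  omega

variable {m d n : ℕ} [NeZero m]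

/-- The clique of the first point meets the first points of exactly those sectors whose
number is divisible by `l`; hence its orbit under the rotation consists of `l` cliques. -/
def HasOrbitCard (l : ℕ) (r : Setoid (SectorPoint m (n + 1))) : Prop :=
  ∀ g, r (g, 0) (0, 0) ↔ l ∣ g.val

theorem hasStabilizer_castHom_iff {l : ℕ} (hl : l ∣ m) (r : Setoid (SectorPoint m (n + 1))) :
    HasStabilizer (ZMod.castHom hl (ZMod l)).toAddMonoidHom r ↔ HasOrbitCard l r := by
  refine forall_congr' fun g => ?_
  have : (ZMod.castHom hl (ZMod l)).toAddMonoidHom g = ((g.val : ℕ) : ZMod l) := by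
    conv_lhs => rw [← ZMod.natCast_zmod_val g]
    exact map_natCast (ZMod.castHom hl (ZMod l)) _
  rw [this, ZMod.natCast_eq_zero_iff]

theorem existsUnique_hasOrbitCard {r : Setoid (SectorPoint m (n + 1))}
    (hr : IsMLinearDiagram m d (n + 1) r) : ∃! l, l ∈ m.divisors ∧ HasOrbitCard l r := by
  have hm : m ≠ 0 := NeZero.ne m
  have hadd : ∀ g h : ZMod m, r (g, 0) (0, 0) → r (h, 0) (0, 0) → r (g + h, 0) (0, 0) := by
    intro g h hg hh
    have := (hr.translate h g 0 0 0).mpr hg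
    rw [zero_add] at this
    exact r.trans this hh
  -- The stabilizer, pulled back to `ℤ`, where subgroups are generated by one element.
  let H : AddSubgroup ℤ :=
    { carrier := {k | r ((k : ZMod m), 0) (0, 0)}
      add_mem' := fun {a b} ha hb => by
        simpa using hadd a b ha hb
      zero_mem' := by simp
      neg_mem' := fun {a} ha => by
        have := (hr.translate (-(a : ZMod m)) a 0 0 0).mpr ha
        rw [add_neg_cancel, zero_add] at this
        simpa using r.symm this }
  have hH : ∀ k : ℤ, r ((k : ZMod m), 0) (0, 0) ↔ k ∈ H := fun k => Iff.rfl
  obtain ⟨a, ha⟩ := Int.subgroup_cyclic H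
  have hdvd : ∀ k : ℕ, r ((k : ZMod m), 0) (0, 0) ↔ a.natAbs ∣ k := by
    intro k
    have := hH k
    rw [Int.cast_natCast, ha, AddSubgroup.mem_closure_singleton] at this
    rw [this, ← Int.natCast_dvd_natCast, Int.natAbs_dvd]
    constructor
    · rintro ⟨z, hz⟩
      exact ⟨z, by rw [← hz, smul_eq_mul, mul_comm]⟩
    · rintro ⟨z, hz⟩
      exact ⟨z, by rw [hz, smul_eq_mul, mul_comm]⟩
  have hval : ∀ g : ZMod m, r (g, 0) (0, 0) ↔ a.natAbs ∣ g.val := by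
    intro g
    rw [← hdvd, ZMod.natCast_zmod_val]
  have hdvd_iff : ∀ l, HasOrbitCard l r → l ∣ m → ∀ k : ℕ,
      r ((k : ZMod m), 0) (0, 0) ↔ l ∣ k := by
    intro l h hl k
    rw [h, ZMod.val_natCast, Nat.dvd_mod_iff hl]
  have ham : a.natAbs ∣ m := by
    rw [← hdvd, ZMod.natCast_self]
  refine ⟨a.natAbs, ⟨Nat.mem_divisors.mpr ⟨ham, hm⟩, hval⟩, ?_⟩
  rintro l ⟨hl, h⟩
  have hl' := hdvd_iff l h (Nat.dvd_of_mem_divisors hl)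
  exact Nat.dvd_antisymm ((hl' _).mp ((hdvd _).mpr dvd_rfl)) ((hdvd _).mp ((hl' _).mpr dvd_rfl))

theorem numMLinear_eq_sum_divisors (m d n k : ℕ) [NeZero m] :
    numMLinear m d (n + 1) k = ∑ l ∈ m.divisors,
      {r : Setoid (SectorPoint m (n + 1)) | IsMLinearDiagram m d (n + 1) r ∧
        (∀ s, (sectorLoops r s).ncard = k) ∧ HasOrbitCard l r}.ncard := by
  classical
  have : Fintype (Setoid (SectorPoint m (n + 1))) := Fintype.ofFinite _
  have h1 : ∀ P : Setoid (SectorPoint m (n + 1)) → Prop,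
      {r | P r}.ncard = (Finset.univ.filter P).card := by
    intro P
    rw [← Set.ncard_coe_finset]
    simp
  rw [numMLinear, h1]
  simp only [h1, ← and_assoc, Finset.card_filter]
  rw [Finset.sum_comm]
  refine Finset.sum_congr rfl fun r _ => ?_
  split_ifs with hr
  · obtain ⟨l, ⟨hl, hlr⟩, hu⟩ := existsUnique_hasOrbitCard hr.1
    simp only [hr.1, hr.2, true_and, implies_true]
    rw [← Finset.card_filter, eq_comm, Finset.card_eq_one]
    refine ⟨l, Finset.ext fun l' => ?_⟩
    rw [Finset.mem_filter, Finset.mem_singleton]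
    exact ⟨fun h => hu l' h, fun h => h ▸ ⟨hl, hlr⟩⟩
  · exact (Finset.sum_eq_zero fun l _ => if_neg fun h => hr h.1).symm

theorem mul_ncard_ker_castHom {l : ℕ} (hl : l ∣ m) :
    l * {s | (ZMod.castHom hl (ZMod l)).toAddMonoidHom s = 0}.ncard = m := by
  classical
  have : NeZero l := ⟨fun h => NeZero.ne m (Nat.eq_zero_of_zero_dvd (h ▸ hl))⟩
  have h1 := Finset.card_eq_sum_card_fiberwise (s := (Finset.univ : Finset (ZMod m)))
    (t := (Finset.univ : Finset (ZMod l))) (f := (ZMod.castHom hl (ZMod l)).toAddMonoidHom)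
    (fun _ _ => Finset.mem_coe.mpr (Finset.mem_univ _))
  have h2 : ∀ x, (Finset.univ.filter fun s =>
      (ZMod.castHom hl (ZMod l)).toAddMonoidHom s = x).card =
        {s | (ZMod.castHom hl (ZMod l)).toAddMonoidHom s = 0}.ncard := by
    intro x
    rw [← ncard_fiber_eq _ (ZMod.castHom_surjective hl) x, ← Set.ncard_coe_finset]
    congr 1
    ext s
    rw [Finset.mem_coe, Finset.mem_filter, and_iff_right (Finset.mem_univ _)]
    rfl
  rw [Finset.sum_congr rfl fun x _ => h2 x, Finset.sum_const, Finset.card_univ, Finset.card_univ,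
    ZMod.card, ZMod.card, smul_eq_mul] at h1
  exact h1.symm

end Assembly

theorem mainTheorem7 (m d v k : ℕ) (hm : 1 ≤ m) (hd : 1 ≤ d) (hv : 1 ≤ v) :
    (numMLinear m d v k : ℚ) =
      ∑ l ∈ m.divisors with m ∣ l * d ∧ l * d / m ≤ v,
        ∑ t ∈ Finset.Icc (k + 1 - l * d / m) (k + l * d / m - 1),
          cCoeff l (l * d / m) v k t * (numMLinear m d (v - l * d / m) t : ℚ) := by
  obtain ⟨n, rfl⟩ : ∃ n, v = n + 1 := ⟨v - 1, by omega⟩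
  have : NeZero m := ⟨by omega⟩
  rw [numMLinear_eq_sum_divisors, Finset.sum_filter, Nat.cast_sum]
  refine Finset.sum_congr rfl fun l hl => ?_
  have hlm := Nat.dvd_of_mem_divisors hl
  have hl0 : 0 < l := Nat.pos_of_mem_divisors hl
  have : NeZero l := ⟨hl0.ne'⟩
  have hK := mul_ncard_ker_castHom hlm
  have hπ : Function.Surjective (ZMod.castHom hlm (ZMod l)).toAddMonoidHom :=
    ZMod.castHom_surjective hlm
  simp only [← hasStabilizer_castHom_iff hlm]
  split_ifs with h
  · obtain ⟨⟨e, he⟩, hev⟩ := h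
    have hediv : l * d / m = e := by rw [he, Nat.mul_div_cancel_left e hm]
    rw [hediv] at hev ⊢
    have he1 : 1 ≤ e := by
      refine Nat.pos_of_ne_zero fun h0 => ?_
      rw [h0, mul_zero] at he
      exact (Nat.mul_pos hl0 hd).ne' he
    have heK : e * {s | (ZMod.castHom hlm (ZMod l)).toAddMonoidHom s = 0}.ncard = d := by
      refine Nat.eq_of_mul_eq_mul_left hl0 ?_
      rw [he, mul_left_comm, hK, mul_comm]
    rw [ncard_hasStabilizer _ hπ (w := n + 1 - e) (by omega) he1 heK hd, ZMod.card]
    -- Outside the common range of `t`, either the coefficient or the number of diagrams vanishes.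
    refine Finset.sum_congr_of_eq_on_inter (fun t _ ht => ?_) (fun t _ ht => ?_)
      fun _ _ _ => rfl
    · rw [Finset.mem_Icc] at ht
      rw [cCoeff_eq_zero (by omega), zero_mul]
    · rw [Finset.mem_range] at ht
      rw [numMLinear_eq_zero (by omega), Nat.cast_zero, mul_zero]
  -- The clique of the first point has `d` points, which forces the divisibility.
  · rw [Nat.cast_eq_zero, Set.ncard_eq_zero (Set.toFinite _), Set.eq_empty_iff_forall_notMem]
    rintro r ⟨hr, -, hs⟩
    have h1 := card_colourWord _ hπ hr hs
    refine h ?_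
    have h2 : l * d = m * (n + 1 - (oldSet (colourWord
        (ZMod.castHom hlm (ZMod l)).toAddMonoidHom r)).card) := by
      rw [← h1, mul_left_comm, hK, mul_comm]
    refine ⟨⟨_, h2⟩, ?_⟩
    rw [h2, Nat.mul_div_cancel_left _ hm]
    exact Nat.sub_le _ _
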